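/- Let $V$ be a complex vector space of finite dimension $p\ge 1$, and let $c\in S^3V^*$ be a cubic form on $V$, regarded as a symmetric trilinear form, such that the map $B:S^2V\to V^*$, $B(v_1,v_2)=c(v_1,v_2,\cdot)$, is surjective. Let $W$ be a complex vector space of dimension $2$ and $\omega\in\wedge^2W^*$ a non-zero $2$-form. Let $\mathfrak n=\mathfrak n_1\oplus\mathfrak n_2\oplus\mathfrak n_3$, where $\mathfrak n_1=V\otimes W$, $\mathfrak n_2=V^*$, $\mathfrak n_3=W$, be the graded nilpotent Lie algebra with brackets $$[v_1\otimes w_1,v_2\otimes w_2]=\omega(w_1,w_2)\,B(v_1,v_2),\qquad [v_1^*,v_2\otimes w_2]=v_1^*(v_2)\,w_2,$$ all other brackets of homogeneous elements (up to antisymmetry) being zero. Let $N=\exp(\mathfrak n)$ be the corresponding unipotent algebraic group, with the group law given by the Campbell--Hausdorff formula, and for a point $\ell\in\mathbb P W$, with corresponding line $\hat\ell\subset W$, let $A_\ell=\exp(V\otimes\hat\ell)\subset N$, an abelian subgroup. Let $X_c$ be the family of quotients $\{N/A_\ell,\ \ell\in\mathbb P W\}$, with the structure of algebraic variety for which the natural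 map $\xi:N\times\mathbb P W\to X_c$ is a quotient map: a subset of $X_c$ is Zariski open if and only if its preimage is, and a function on an open subset $U$ is regular if and only if its composition with $\xi$ is regular on $\xi^{-1}(U)$. Then $X_c$ is rationally chain connected: any two points of $X_c$ can be joined by a finite chain of complete rational curves in $X_c$ (images of non-constant morphisms $\mathbb P^1\to X_c$), consecutive curves of the chain having a common point. In particular, $X_c$ is quasi-complete: every regular function on $X_c$ is constant. -/

import Mathlib

open scoped TensorProduct Topology LinearAlgebra.Projectivization

noncomputable section

universe u v

/-! ### Spaces with functions

Complex algebraic varieties are treated in the classical language: a Zariski topology together with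
the sheaf of complex valued regular functions. As a sheaf of functions is determined by its germs,
it is recorded by the relation "`f` is regular at `x`"; this relation depends only on the germ of
the function `f` at `x`, and a function is a section over an open set `U` if and only if it is
regular at each point of `U`. -/

/-- A space with functions over `ℂ`: a topological space with a sheaf of `ℂ`-algebras of complex
valued functions, such that non-vanishing of a regular function is an open condition and the
inverse of a regular function is regular where the function does not vanish. -/
structure SpaceWithFunctions where
  /-- the set of points -/
  carrier : Type u
  /-- the (Zariski) topology -/
  top : TopologicalSpace carrier
  /-- `RegularAt f x` means that the germ of `f` at `x` is regular -/
  RegularAt : (carrier → ℂ) → carrier → Prop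
  regularAt_congr : ∀ {f g : carrier → ℂ} {x : carrier},
    f =ᶠ[𝓝 x] g → RegularAt f x → RegularAt g x
  regularAt_eventually : ∀ {f : carrier → ℂ} {x : carrier},
    RegularAt f x → ∀ᶠ y in 𝓝 x, RegularAt f y
  regularAt_const : ∀ (a : ℂ) (x : carrier), RegularAt (fun _ => a) x
  regularAt_add : ∀ {f g : carrier → ℂ} {x : carrier},
    RegularAt f x → RegularAt g x → RegularAt (f + g) x
  regularAt_mul : ∀ {f g : carrier → ℂ} {x : carrier},
    RegularAt f x → RegularAt g x → RegularAt (f * g) x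
  eventually_ne_zero : ∀ {f : carrier → ℂ} {x : carrier},
    RegularAt f x → f x ≠ 0 → ∀ᶠ y in 𝓝 x, f y ≠ 0
  regularAt_inv : ∀ {f : carrier → ℂ} {x : carrier},
    RegularAt f x → f x ≠ 0 → RegularAt f⁻¹ x

namespace SpaceWithFunctions

instance : CoeSort SpaceWithFunctions.{u} (Type u) := ⟨SpaceWithFunctions.carrier⟩

instance (X : SpaceWithFunctions.{u}) : TopologicalSpace X := X.top

/-- `f` is a regular function on the subset `U` (used for open `U`). -/
def RegularOn (X : SpaceWithFunctions.{u}) (f : X → ℂ) (U : Set X) : Prop :=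
  ∀ x ∈ U, X.RegularAt f x

/-- Morphisms: continuous maps along which regular functions pull back to regular functions. -/
structure IsMorphism {X : SpaceWithFunctions.{u}} {Y : SpaceWithFunctions.{v}} (φ : X → Y) :
    Prop where
  continuous : Continuous φ
  regularAt_comp : ∀ (f : Y → ℂ) (x : X), Y.RegularAt f (φ x) → X.RegularAt (f ∘ φ) x

/-- A subset of `X` with the induced topology; its regular functions are the functions that are
locally restrictions of regular functions of `X`. -/
def subspace (X : SpaceWithFunctions.{u}) (S : Set X) : SpaceWithFunctions.{u} where
  carrier := S
  top := inferInstance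
  RegularAt f x := ∃ g : X → ℂ, X.RegularAt g x ∧ ∀ᶠ y : S in 𝓝 x, f y = g y
  regularAt_congr := by
    rintro f g x h ⟨e, he, hf⟩
    refine ⟨e, he, ?_⟩
    filter_upwards [h, hf] with y h1 h2
    rw [← h1, h2]
  regularAt_eventually := by
    rintro f x ⟨e, he, hf⟩
    filter_upwards [continuous_subtype_val.continuousAt.eventually (X.regularAt_eventually he),
      hf.eventually_nhds] with y h1 h2
    exact ⟨e, h1, h2⟩
  regularAt_const a x := ⟨fun _ => a, X.regularAt_const a x, by simp⟩
  regularAt_add := by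
    rintro f g x ⟨e, he, hf⟩ ⟨e', he', hf'⟩
    refine ⟨e + e', X.regularAt_add he he', ?_⟩
    filter_upwards [hf, hf'] with y h1 h2
    simp [h1, h2]
  regularAt_mul := by
    rintro f g x ⟨e, he, hf⟩ ⟨e', he', hf'⟩
    refine ⟨e * e', X.regularAt_mul he he', ?_⟩
    filter_upwards [hf, hf'] with y h1 h2
    simp [h1, h2]
  eventually_ne_zero := by
    rintro f x ⟨e, he, hf⟩ hx
    have hx' : e x ≠ 0 := by rwa [← hf.self_of_nhds]
    filter_upwards [hf,
      continuous_subtype_val.continuousAt.eventually (X.eventually_ne_zero he hx')] with y h1 h2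
    rwa [h1]
  regularAt_inv := by
    rintro f x ⟨e, he, hf⟩ hx
    have hx' : e x ≠ 0 := by rwa [← hf.self_of_nhds]
    refine ⟨e⁻¹, X.regularAt_inv he hx', ?_⟩
    filter_upwards [hf] with y h1
    simp [h1]

/-- The quotient structure along a map `q`: a set is open if and only if its preimage is open, and
a function `f` is regular on an open set `U` if and only if `f ∘ q` is regular on `q ⁻¹' U`. -/
def coinduced (X : SpaceWithFunctions.{u}) {Q : Type v} (q : X → Q) : SpaceWithFunctions.{v} where
  carrier := Q
  top := TopologicalSpace.coinduced q X.top
  RegularAt f y := ∃ U : Set Q, IsOpen[TopologicalSpace.coinduced q X.top] U ∧ y ∈ U ∧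
    X.RegularOn (f ∘ q) (q ⁻¹' U)
  regularAt_congr := by
    let _ : TopologicalSpace Q := TopologicalSpace.coinduced q X.top
    have hq : Continuous q := continuous_coinduced_rng
    rintro f g y h ⟨U, hU, hy, hf⟩
    obtain ⟨T, hT, hTo, hyT⟩ := eventually_nhds_iff.1 h
    refine ⟨U ∩ T, hU.inter hTo, ⟨hy, hyT⟩, fun x hx => X.regularAt_congr ?_ (hf x hx.1)⟩
    filter_upwards [(hTo.preimage hq).mem_nhds hx.2] with z hz using hT _ hz
  regularAt_eventually := by
    let _ : TopologicalSpace Q := TopologicalSpace.coinduced q X.top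
    rintro f y ⟨U, hU, hy, hf⟩
    exact eventually_nhds_iff.2 ⟨U, fun z hz => ⟨U, hU, hz, hf⟩, hU, hy⟩
  regularAt_const a y := by
    let _ : TopologicalSpace Q := TopologicalSpace.coinduced q X.top
    exact ⟨Set.univ, isOpen_univ, trivial, fun x _ => X.regularAt_const a x⟩
  regularAt_add := by
    let _ : TopologicalSpace Q := TopologicalSpace.coinduced q X.top
    rintro f g y ⟨U, hU, hy, hf⟩ ⟨U', hU', hy', hf'⟩
    exact ⟨U ∩ U', hU.inter hU', ⟨hy, hy'⟩,
      fun x hx => X.regularAt_add (hf x hx.1) (hf' x hx.2)⟩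
  regularAt_mul := by
    let _ : TopologicalSpace Q := TopologicalSpace.coinduced q X.top
    rintro f g y ⟨U, hU, hy, hf⟩ ⟨U', hU', hy', hf'⟩
    exact ⟨U ∩ U', hU.inter hU', ⟨hy, hy'⟩,
      fun x hx => X.regularAt_mul (hf x hx.1) (hf' x hx.2)⟩
  eventually_ne_zero := by
    let _ : TopologicalSpace Q := TopologicalSpace.coinduced q X.top
    have hq : Continuous q := continuous_coinduced_rng
    rintro f y ⟨U, hU, hy, hf⟩ hfy
    refine eventually_nhds_iff.2 ⟨U ∩ {z | f z ≠ 0}, fun z hz => hz.2, ?_, hy, hfy⟩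
    refine isOpen_coinduced.2 (isOpen_iff_eventually.2 fun x hx => ?_)
    filter_upwards [(hU.preimage hq).mem_nhds hx.1,
      X.eventually_ne_zero (hf x hx.1) hx.2] with z h1 h2 using ⟨h1, h2⟩
  regularAt_inv := by
    let _ : TopologicalSpace Q := TopologicalSpace.coinduced q X.top
    have hq : Continuous q := continuous_coinduced_rng
    rintro f y ⟨U, hU, hy, hf⟩ hfy
    refine ⟨U ∩ {z | f z ≠ 0}, ?_, ⟨hy, hfy⟩, fun x hx => X.regularAt_inv (hf x hx.1) hx.2⟩
    refine isOpen_coinduced.2 (isOpen_iff_eventually.2 fun x hx => ?_)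
    filter_upwards [(hU.preimage hq).mem_nhds hx.1,
      X.eventually_ne_zero (hf x hx.1) hx.2] with z h1 h2 using ⟨h1, h2⟩

section LocalFractions

variable {T : Type u}

/-- Bookkeeping for the two constructions below. A chart `i : ι` has a domain `dom i` and an
algebra `alg i` of functions. The structure defined here has the sets
`{z ∈ dom i | q z ≠ 0}`, `q ∈ alg i`, as a basis of its topology, and its regular functions are
locally fractions `p / q` with `p q ∈ alg i`. -/
def localFractions {ι : Type v} (dom : ι → Set T) (alg : ι → Subalgebra ℂ (T → ℂ))
    (cover : ∀ z, ∃ i, z ∈ dom i)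
    (inter : ∀ i j, ∃ k, dom k = dom i ∩ dom j ∧ alg i ≤ alg k ∧ alg j ≤ alg k) :
    SpaceWithFunctions.{u} :=
  let τ : TopologicalSpace T :=
    { IsOpen := fun S => ∀ z ∈ S, ∃ i, z ∈ dom i ∧ ∃ q ∈ alg i, q z ≠ 0 ∧
        ∀ w ∈ dom i, q w ≠ 0 → w ∈ S
      isOpen_univ := fun z _ => by
        obtain ⟨i, hi⟩ := cover z
        exact ⟨i, hi, 1, one_mem _, by simp, by simp⟩
      isOpen_inter := by
        rintro S S' h h' z ⟨hz, hz'⟩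
        obtain ⟨i, hi, q, hq, hqz, H⟩ := h z hz
        obtain ⟨j, hj, r, hr, hrz, H'⟩ := h' z hz'
        obtain ⟨k, hk, hik, hjk⟩ := inter i j
        refine ⟨k, hk ▸ ⟨hi, hj⟩, q * r, mul_mem (hik hq) (hjk hr), mul_ne_zero hqz hrz, ?_⟩
        intro w hw hqr
        rw [hk] at hw
        exact ⟨H w hw.1 (left_ne_zero_of_mul hqr), H' w hw.2 (right_ne_zero_of_mul hqr)⟩
      isOpen_sUnion := by
        rintro C h z ⟨S, hS, hz⟩
        obtain ⟨i, hi, q, hq, hqz, H⟩ := h S hS z hz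
        exact ⟨i, hi, q, hq, hqz, fun w hw hw' => ⟨S, hS, H w hw hw'⟩⟩ }
  have basic : ∀ i, ∀ q ∈ alg i, IsOpen[τ] {w | w ∈ dom i ∧ q w ≠ 0} :=
    fun i q hq z hz => ⟨i, hz.1, q, hq, hz.2, fun _ h h' => ⟨h, h'⟩⟩
  { carrier := T
    top := τ
    RegularAt := fun f z => ∃ i, z ∈ dom i ∧ ∃ p ∈ alg i, ∃ q ∈ alg i, q z ≠ 0 ∧
      ∀ w ∈ dom i, q w ≠ 0 → f w = p w / q w
    regularAt_congr := by
      rintro f g z h ⟨i, hi, p, hp, q, hq, hqz, H⟩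
      obtain ⟨S, hS, hSo, hzS⟩ := (@eventually_nhds_iff T τ z _).1 h
      obtain ⟨j, hj, r, hr, hrz, H'⟩ := hSo z hzS
      obtain ⟨k, hk, hik, hjk⟩ := inter i j
      refine ⟨k, hk ▸ ⟨hi, hj⟩, p * r, mul_mem (hik hp) (hjk hr), q * r,
        mul_mem (hik hq) (hjk hr), mul_ne_zero hqz hrz, fun w hw hqr => ?_⟩
      rw [hk] at hw
      have h1 := left_ne_zero_of_mul hqr
      have h2 := right_ne_zero_of_mul hqr
      rw [← hS w (H' w hw.2 h2), H w hw.1 h1]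
      simp only [Pi.mul_apply]
      rw [mul_div_mul_right _ _ h2]
    regularAt_eventually := by
      rintro f z ⟨i, hi, p, hp, q, hq, hqz, H⟩
      exact (@eventually_nhds_iff T τ z _).2 ⟨_, fun w hw => ⟨i, hw.1, p, hp, q, hq, hw.2, H⟩,
        basic i q hq, hi, hqz⟩
    regularAt_const := fun a z => by
      obtain ⟨i, hi⟩ := cover z
      exact ⟨i, hi, algebraMap ℂ _ a, Subalgebra.algebraMap_mem _ a, 1, one_mem _, by simp,
        by simp⟩
    regularAt_add := by
      rintro f g z ⟨i, hi, p, hp, q, hq, hqz, H⟩ ⟨j, hj, p', hp', q', hq', hqz', H'⟩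
      obtain ⟨k, hk, hik, hjk⟩ := inter i j
      refine ⟨k, hk ▸ ⟨hi, hj⟩, p * q' + q * p',
        add_mem (mul_mem (hik hp) (hjk hq')) (mul_mem (hik hq) (hjk hp')), q * q',
        mul_mem (hik hq) (hjk hq'), mul_ne_zero hqz hqz', fun w hw hqr => ?_⟩
      rw [hk] at hw
      have h1 := left_ne_zero_of_mul hqr
      have h2 := right_ne_zero_of_mul hqr
      simp only [Pi.add_apply, Pi.mul_apply]
      rw [H w hw.1 h1, H' w hw.2 h2, div_add_div _ _ h1 h2]
    regularAt_mul := by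
      rintro f g z ⟨i, hi, p, hp, q, hq, hqz, H⟩ ⟨j, hj, p', hp', q', hq', hqz', H'⟩
      obtain ⟨k, hk, hik, hjk⟩ := inter i j
      refine ⟨k, hk ▸ ⟨hi, hj⟩, p * p', mul_mem (hik hp) (hjk hp'), q * q',
        mul_mem (hik hq) (hjk hq'), mul_ne_zero hqz hqz', fun w hw hqr => ?_⟩
      rw [hk] at hw
      have h1 := left_ne_zero_of_mul hqr
      have h2 := right_ne_zero_of_mul hqr
      simp only [Pi.mul_apply]
      rw [H w hw.1 h1, H' w hw.2 h2, div_mul_div_comm]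
    eventually_ne_zero := by
      rintro f z ⟨i, hi, p, hp, q, hq, hqz, H⟩ hz
      refine (@eventually_nhds_iff T τ z _).2 ⟨{w | w ∈ dom i ∧ (p * q) w ≠ 0}, fun w hw => ?_,
        basic i _ (mul_mem hp hq), hi, ?_⟩
      · have h1 := left_ne_zero_of_mul hw.2
        have h2 := right_ne_zero_of_mul hw.2
        rw [H w hw.1 h2]
        exact div_ne_zero h1 h2
      · rw [H z hi hqz] at hz
        exact mul_ne_zero (div_ne_zero_iff.1 hz).1 hqz
    regularAt_inv := by
      rintro f z ⟨i, hi, p, hp, q, hq, hqz, H⟩ hz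
      rw [H z hi hqz] at hz
      refine ⟨i, hi, q * q, mul_mem hq hq, p * q, mul_mem hp hq,
        mul_ne_zero (div_ne_zero_iff.1 hz).1 hqz, fun w hw hpq => ?_⟩
      have h1 := left_ne_zero_of_mul hpq
      have h2 := right_ne_zero_of_mul hpq
      simp only [Pi.inv_apply, Pi.mul_apply]
      rw [H w hw h2, inv_div, mul_div_mul_right _ _ h2] }

end LocalFractions

/-- The polynomial functions on a complex vector space: the algebra of functions generated by the
linear forms. -/
def polynomialFunctions (E : Type u) [AddCommGroup E] [Module ℂ E] : Subalgebra ℂ (E → ℂ) :=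
  Algebra.adjoin ℂ (Set.range fun (φ : Module.Dual ℂ E) (x : E) => φ x)

/-- A finite dimensional complex vector space as an affine space: the sets `q ≠ 0`, `q` polynomial,
form a basis of the Zariski topology, and regular functions are locally fractions `p / q` of
polynomial functions. -/
def affineSpace (E : Type u) [AddCommGroup E] [Module ℂ E] : SpaceWithFunctions.{u} :=
  localFractions (ι := Unit) (fun _ => (Set.univ : Set E)) (fun _ => polynomialFunctions E)
    (fun _ => ⟨(), trivial⟩) (fun _ _ => ⟨(), by simp, le_rfl, le_rfl⟩)

/-- The projective space of lines in `E`, as the quotient of the open subset `E ∖ {0}` of the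
affine space `E`. -/
def projectiveSpace (E : Type u) [AddCommGroup E] [Module ℂ E] : SpaceWithFunctions.{u} :=
  ((affineSpace E).subspace {x : E | x ≠ 0}).coinduced (Projectivization.mk' (K := ℂ) (V := E))

/-- The algebra of functions on `U × V` generated by the regular functions on the open set `U` of
`X` and the regular functions on the open set `V` of `Y`, that is, the functions
`(x, y) ↦ ∑ i, f i x * g i y` with `f i`, `g i` regular on `U`, `V`. -/
def boxFunctions (X : SpaceWithFunctions.{u}) (Y : SpaceWithFunctions.{v}) (U : Set X)
    (V : Set Y) : Subalgebra ℂ (X × Y → ℂ) :=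
  Algebra.adjoin ℂ ({h | ∃ f : X → ℂ, X.RegularOn f U ∧ h = fun z => f z.1} ∪
    {h | ∃ g : Y → ℂ, Y.RegularOn g V ∧ h = fun z => g z.2})

lemma boxFunctions_mono (X : SpaceWithFunctions.{u}) (Y : SpaceWithFunctions.{v}) {U U' : Set X}
    {V V' : Set Y} (hU : U' ⊆ U) (hV : V' ⊆ V) : boxFunctions X Y U V ≤ boxFunctions X Y U' V' := by
  refine Algebra.adjoin_mono (Set.union_subset_union ?_ ?_)
  · rintro h ⟨f, hf, rfl⟩
    exact ⟨f, fun x hx => hf x (hU hx), rfl⟩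
  · rintro h ⟨f, hf, rfl⟩
    exact ⟨f, fun x hx => hf x (hV hx), rfl⟩

/-- The product of two spaces with functions. Its topology is finer than the product topology: the
sets `{z ∈ U × V | q z ≠ 0}` form a basis, where `U`, `V` are open and `q` is a sum of products of
regular functions on `U` and on `V`; regular functions are locally fractions `p / q` of such sums.
-/
def prod (X : SpaceWithFunctions.{u}) (Y : SpaceWithFunctions.{v}) :
    SpaceWithFunctions.{max u v} :=
  localFractions (T := X × Y) (ι := TopologicalSpace.Opens X × TopologicalSpace.Opens Y)
    (fun i => (i.1 : Set X) ×ˢ (i.2 : Set Y)) (fun i => boxFunctions X Y i.1 i.2)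
    (fun _ => ⟨(⊤, ⊤), by simp⟩)
    (fun i j => ⟨(i.1 ⊓ j.1, i.2 ⊓ j.2), by simp [Set.prod_inter_prod],
      boxFunctions_mono X Y (by simp) (by simp), boxFunctions_mono X Y (by simp) (by simp)⟩)

/-- A (complete) rational curve in `X`: the image of a non-constant morphism from the projective
line to `X`. -/
def IsRationalCurve (X : SpaceWithFunctions.{u}) (C : Set X) : Prop :=
  ∃ φ : projectiveSpace (Fin 2 → ℂ) → X,
    IsMorphism φ ∧ (∃ s t, φ s ≠ φ t) ∧ C = Set.range φ

/-- `X` is rationally chain connected: any two points `x`, `y` are joined by a finite chain of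
rational curves, that is, there are points `x = x₀, x₁, …, xₙ = y` such that `xᵢ` and `xᵢ₊₁` lie on
a common complete rational curve in `X`. -/
def RationallyChainConnected (X : SpaceWithFunctions.{u}) : Prop :=
  ∀ x y : X, Relation.ReflTransGen (fun a b => ∃ C, X.IsRationalCurve C ∧ a ∈ C ∧ b ∈ C) x y

/-- `X` is quasi-complete: every regular function on `X` is constant. -/
def QuasiComplete (X : SpaceWithFunctions.{u}) : Prop :=
  ∀ f : X → ℂ, X.RegularOn f Set.univ → ∃ a : ℂ, ∀ x, f x = a

end SpaceWithFunctions

/-! ### The nilpotent Lie algebra of a cubic form -/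

/-- A cubic form on `V`, given as a symmetric trilinear form. -/
structure CubicForm (V : Type u) [AddCommGroup V] [Module ℂ V] where
  /-- the underlying trilinear form -/
  toLin : V →ₗ[ℂ] V →ₗ[ℂ] V →ₗ[ℂ] ℂ
  symm_left : ∀ x y z, toLin x y z = toLin y x z
  symm_right : ∀ x y z, toLin x y z = toLin x z y

section

variable {V : Type u} [AddCommGroup V] [Module ℂ V] {W : Type v} [AddCommGroup W] [Module ℂ W]

/-- The system of quadrics `B : v₁ ⊗ v₂ ↦ c(v₁, v₂, ·)` of a cubic form, with values in the dual
of `V`. As `B` is symmetric, it has the same image as the induced map on the symmetric square. -/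
def CubicForm.quadrics (c : CubicForm V) : V ⊗[ℂ] V →ₗ[ℂ] Module.Dual ℂ V :=
  TensorProduct.lift c.toLin

/-- The bilinear map `(w₁, w₂) ↦ ω(w₁, w₂)` of an alternating 2-form. -/
def twoFormBilin (ω : W [⋀^Fin 2]→ₗ[ℂ] ℂ) : W →ₗ[ℂ] W →ₗ[ℂ] ℂ :=
  LinearMap.mk₂ ℂ (fun w₁ w₂ => ω ![w₁, w₂])
    (fun a b w => by simpa using ω.map_vecCons_add ![w] a b)
    (fun r a w => by simpa using ω.map_vecCons_smul ![w] r a)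
    (fun w a b => (ω.curryLeft w).map_vecCons_add ![] a b)
    (fun r w a => (ω.curryLeft w).map_vecCons_smul ![] r a)

lemma twoFormBilin_apply (ω : W [⋀^Fin 2]→ₗ[ℂ] ℂ) (w w' : W) :
    twoFormBilin ω w w' = ω ![w, w'] := rfl

lemma twoFormBilin_self (ω : W [⋀^Fin 2]→ₗ[ℂ] ℂ) (w : W) : twoFormBilin ω w w = 0 :=
  ω.map_eq_zero_of_eq ![w, w] (i := 0) (j := 1) rfl (by decide)

lemma twoFormBilin_swap (ω : W [⋀^Fin 2]→ₗ[ℂ] ℂ) (w w' : W) :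
    twoFormBilin ω w w' = -twoFormBilin ω w' w := by
  have h := twoFormBilin_self ω (w + w')
  simp only [map_add, LinearMap.add_apply, twoFormBilin_self] at h
  linear_combination h

/-- In dimension two, `ω(w₁, w₂) w₃ + ω(w₂, w₃) w₁ + ω(w₃, w₁) w₂ = 0`. -/
lemma twoFormBilin_cyclic [hW : Fact (Module.finrank ℂ W = 2)] (ω : W [⋀^Fin 2]→ₗ[ℂ] ℂ)
    (w₁ w₂ w₃ : W) : twoFormBilin ω w₁ w₂ • w₃ + twoFormBilin ω w₂ w₃ • w₁ +
      twoFormBilin ω w₃ w₁ • w₂ = 0 := by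
  have : FiniteDimensional ℂ W := Module.finite_of_finrank_pos (by rw [hW.out]; norm_num)
  let b := Module.finBasisOfFinrankEq ℂ W hW.out
  have e : ∀ w : W, ∃ x y : ℂ, w = x • b 0 + y • b 1 := fun w =>
    ⟨b.repr w 0, b.repr w 1, by
      rw [← Fin.sum_univ_two (fun i => b.repr w i • b i)]; exact (b.sum_repr w).symm⟩
  obtain ⟨x₁, y₁, rfl⟩ := e w₁
  obtain ⟨x₂, y₂, rfl⟩ := e w₂
  obtain ⟨x₃, y₃, rfl⟩ := e w₃
  simp only [map_add, map_smul, LinearMap.add_apply, LinearMap.smul_apply, twoFormBilin_self,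
    twoFormBilin_swap ω (b 1) (b 0), smul_eq_mul]
  module

/-- The bracket `𝔫₁ × 𝔫₁ → 𝔫₂`, `(v₁ ⊗ w₁, v₂ ⊗ w₂) ↦ ω(w₁, w₂) B(v₁, v₂)`. -/
def bracket₁₁ (c : CubicForm V) (ω : W [⋀^Fin 2]→ₗ[ℂ] ℂ) :
    V ⊗[ℂ] W →ₗ[ℂ] V ⊗[ℂ] W →ₗ[ℂ] Module.Dual ℂ V :=
  (TensorProduct.map₂ c.toLin (twoFormBilin ω)).compr₂ (TensorProduct.rid ℂ _).toLinearMap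

/-- The bracket `𝔫₂ × 𝔫₁ → 𝔫₃`, `(φ, v ⊗ w) ↦ φ(v) w`. -/
def bracket₂₁ : Module.Dual ℂ V →ₗ[ℂ] V ⊗[ℂ] W →ₗ[ℂ] W :=
  (LinearMap.rTensorHom W).compr₂ (TensorProduct.lid ℂ W).toLinearMap

lemma bracket₁₁_tmul (c : CubicForm V) (ω : W [⋀^Fin 2]→ₗ[ℂ] ℂ) (v₁ v₂ : V) (w₁ w₂ : W) :
    bracket₁₁ c ω (v₁ ⊗ₜ w₁) (v₂ ⊗ₜ w₂) = ω ![w₁, w₂] • c.quadrics (v₁ ⊗ₜ v₂) := by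
  simp [bracket₁₁, twoFormBilin_apply, CubicForm.quadrics]

lemma bracket₂₁_tmul (φ : Module.Dual ℂ V) (v : V) (w : W) :
    bracket₂₁ φ (v ⊗ₜ[ℂ] w) = φ v • w := by
  simp [bracket₂₁]

lemma bracket₁₁_swap (c : CubicForm V) (ω : W [⋀^Fin 2]→ₗ[ℂ] ℂ) (a a' : V ⊗[ℂ] W) :
    bracket₁₁ c ω a a' = -bracket₁₁ c ω a' a := by
  induction a with
  | zero => simp
  | add x y hx hy => simp only [map_add, LinearMap.add_apply, hx, hy, neg_add]
  | tmul v w =>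
    induction a' with
    | zero => simp
    | add x y hx hy => simp only [map_add, LinearMap.add_apply, hx, hy, neg_add]
    | tmul v' w' =>
      ext u
      have h : ω ![w, w'] = -ω ![w', w] := twoFormBilin_swap ω w w'
      simp [bracket₁₁_tmul, CubicForm.quadrics, h, c.symm_left v v']

lemma bracket₁₁_self (c : CubicForm V) (ω : W [⋀^Fin 2]→ₗ[ℂ] ℂ) (a : V ⊗[ℂ] W) :
    bracket₁₁ c ω a a = 0 := by
  ext u
  have h := congrArg (fun f => f u) (bracket₁₁_swap c ω a a)
  simp only [LinearMap.neg_apply] at h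
  simp only [LinearMap.zero_apply]
  linear_combination h / 2

lemma bracket_cyclic [Fact (Module.finrank ℂ W = 2)] (c : CubicForm V)
    (ω : W [⋀^Fin 2]→ₗ[ℂ] ℂ) (x y z : V ⊗[ℂ] W) :
    bracket₂₁ (bracket₁₁ c ω x y) z + bracket₂₁ (bracket₁₁ c ω y z) x +
      bracket₂₁ (bracket₁₁ c ω z x) y = 0 := by
  induction x with
  | zero => simp
  | add x x' hx hx' =>
    simp only [map_add, LinearMap.add_apply]
    linear_combination (norm := module) hx + hx'
  | tmul v₁ w₁ =>
    induction y with
    | zero => simp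
    | add x x' hx hx' =>
      simp only [map_add, LinearMap.add_apply]
      linear_combination (norm := module) hx + hx'
    | tmul v₂ w₂ =>
      induction z with
      | zero => simp
      | add x x' hx hx' =>
        simp only [map_add, LinearMap.add_apply]
        linear_combination (norm := module) hx + hx'
      | tmul v₃ w₃ =>
        have h := congrArg (fun w => c.toLin v₁ v₂ v₃ • w) (twoFormBilin_cyclic ω w₁ w₂ w₃)
        have h₁ : c.toLin v₂ v₃ v₁ = c.toLin v₁ v₂ v₃ := by rw [c.symm_right, c.symm_left]
        have h₂ : c.toLin v₃ v₁ v₂ = c.toLin v₁ v₂ v₃ := by rw [c.symm_left, c.symm_right]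
        simp only [bracket₁₁_tmul, CubicForm.quadrics, TensorProduct.lift.tmul, map_smul,
          LinearMap.smul_apply, bracket₂₁_tmul, h₁, h₂]
        simp only [twoFormBilin_apply] at h
        linear_combination (norm := module) h

/-- The graded vector space `𝔫 = 𝔫₁ ⊕ 𝔫₂ ⊕ 𝔫₃` with `𝔫₁ = V ⊗ W`, `𝔫₂ = V*`, `𝔫₃ = W`. -/
@[ext]
structure NilAlgebra (c : CubicForm V) (ω : W [⋀^Fin 2]→ₗ[ℂ] ℂ) : Type (max u v) where
  /-- the component in `V ⊗ W` -/
  p₁ : V ⊗[ℂ] W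
  /-- the component in `V*` -/
  p₂ : Module.Dual ℂ V
  /-- the component in `W` -/
  p₃ : W

namespace NilAlgebra

variable {c : CubicForm V} {ω : W [⋀^Fin 2]→ₗ[ℂ] ℂ}

instance : Zero (NilAlgebra c ω) := ⟨⟨0, 0, 0⟩⟩
instance : Add (NilAlgebra c ω) := ⟨fun X Y => ⟨X.p₁ + Y.p₁, X.p₂ + Y.p₂, X.p₃ + Y.p₃⟩⟩
instance : Neg (NilAlgebra c ω) := ⟨fun X => ⟨-X.p₁, -X.p₂, -X.p₃⟩⟩
instance : Sub (NilAlgebra c ω) := ⟨fun X Y => ⟨X.p₁ - Y.p₁, X.p₂ - Y.p₂, X.p₃ - Y.p₃⟩⟩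
instance : SMul ℂ (NilAlgebra c ω) := ⟨fun r X => ⟨r • X.p₁, r • X.p₂, r • X.p₃⟩⟩

@[simp] lemma zero_p₁ : (0 : NilAlgebra c ω).p₁ = 0 := rfl
@[simp] lemma add_p₁ (X Y : NilAlgebra c ω) : (X + Y).p₁ = X.p₁ + Y.p₁ := rfl
@[simp] lemma neg_p₁ (X : NilAlgebra c ω) : (-X).p₁ = -X.p₁ := rfl
@[simp] lemma sub_p₁ (X Y : NilAlgebra c ω) : (X - Y).p₁ = X.p₁ - Y.p₁ := rfl
@[simp] lemma smul_p₁ (r : ℂ) (X : NilAlgebra c ω) : (r • X).p₁ = r • X.p₁ := rfl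
@[simp] lemma zero_p₂ : (0 : NilAlgebra c ω).p₂ = 0 := rfl
@[simp] lemma add_p₂ (X Y : NilAlgebra c ω) : (X + Y).p₂ = X.p₂ + Y.p₂ := rfl
@[simp] lemma neg_p₂ (X : NilAlgebra c ω) : (-X).p₂ = -X.p₂ := rfl
@[simp] lemma sub_p₂ (X Y : NilAlgebra c ω) : (X - Y).p₂ = X.p₂ - Y.p₂ := rfl
@[simp] lemma smul_p₂ (r : ℂ) (X : NilAlgebra c ω) : (r • X).p₂ = r • X.p₂ := rfl
@[simp] lemma zero_p₃ : (0 : NilAlgebra c ω).p₃ = 0 := rfl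
@[simp] lemma add_p₃ (X Y : NilAlgebra c ω) : (X + Y).p₃ = X.p₃ + Y.p₃ := rfl
@[simp] lemma neg_p₃ (X : NilAlgebra c ω) : (-X).p₃ = -X.p₃ := rfl
@[simp] lemma sub_p₃ (X Y : NilAlgebra c ω) : (X - Y).p₃ = X.p₃ - Y.p₃ := rfl
@[simp] lemma smul_p₃ (r : ℂ) (X : NilAlgebra c ω) : (r • X).p₃ = r • X.p₃ := rfl

instance : AddCommGroup (NilAlgebra c ω) where
  add_assoc X Y Z := by ext1 <;> simp [add_assoc]
  zero_add X := by ext1 <;> simp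
  add_zero X := by ext1 <;> simp
  neg_add_cancel X := by ext1 <;> simp
  add_comm X Y := by ext1 <;> simp [add_comm]
  sub_eq_add_neg X Y := by ext1 <;> simp [sub_eq_add_neg]
  nsmul := nsmulRec
  zsmul := zsmulRec

instance : Module ℂ (NilAlgebra c ω) where
  one_smul X := by ext1 <;> simp
  mul_smul r s X := by ext1 <;> simp [mul_smul]
  smul_zero r := by ext1 <;> simp
  smul_add r X Y := by ext1 <;> simp
  add_smul r s X := by ext1 <;> simp [add_smul]
  zero_smul X := by ext1 <;> simp

/-- `[v₁ ⊗ w₁, v₂ ⊗ w₂] = ω(w₁, w₂) B(v₁, v₂)`, `[φ, v ⊗ w] = φ(v) w = -[v ⊗ w, φ]`, and all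
other brackets of homogeneous elements vanish. -/
instance : Bracket (NilAlgebra c ω) (NilAlgebra c ω) where
  bracket X Y := ⟨0, bracket₁₁ c ω X.p₁ Y.p₁, bracket₂₁ X.p₂ Y.p₁ - bracket₂₁ Y.p₂ X.p₁⟩

@[simp] lemma bracket_p₁ (X Y : NilAlgebra c ω) : ⁅X, Y⁆.p₁ = 0 := rfl
@[simp] lemma bracket_p₂ (X Y : NilAlgebra c ω) : ⁅X, Y⁆.p₂ = bracket₁₁ c ω X.p₁ Y.p₁ := rfl
@[simp] lemma bracket_p₃ (X Y : NilAlgebra c ω) :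
    ⁅X, Y⁆.p₃ = bracket₂₁ X.p₂ Y.p₁ - bracket₂₁ Y.p₂ X.p₁ := rfl

variable [Fact (Module.finrank ℂ W = 2)]

instance : LieRing (NilAlgebra c ω) where
  add_lie X Y Z := by
    ext1 <;> simp only [bracket_p₁, bracket_p₂, bracket_p₃, add_p₁, add_p₂, add_p₃, map_add,
      LinearMap.add_apply] <;> abel
  lie_add X Y Z := by
    ext1 <;> simp only [bracket_p₁, bracket_p₂, bracket_p₃, add_p₁, add_p₂, add_p₃, map_add,
      LinearMap.add_apply] <;> abel
  lie_self X := by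
    ext1 <;> simp [bracket₁₁_self]
  leibniz_lie X Y Z := by
    ext1
    · simp
    · simp
    · have h := bracket_cyclic c ω X.p₁ Y.p₁ Z.p₁
      rw [bracket₁₁_swap c ω Z.p₁ X.p₁] at h
      simp only [bracket_p₁, bracket_p₂, bracket_p₃, add_p₃, map_zero, map_neg,
        LinearMap.neg_apply] at h ⊢
      linear_combination (norm := module) -h

instance : LieAlgebra ℂ (NilAlgebra c ω) where
  lie_smul r X Y := by
    ext1 <;> simp [smul_sub]

end NilAlgebra

/-- The nilpotent group `N` with Lie algebra `𝔫`. As `𝔫` is nilpotent, the exponential map is a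
bijection from `𝔫` to `N`; so the points of `N` are written `exp X` with `X` in `𝔫`. -/
structure NilGroup (c : CubicForm V) (ω : W [⋀^Fin 2]→ₗ[ℂ] ℂ) : Type (max u v) where
  /-- the exponential map -/
  exp ::
  /-- the logarithm, inverse to the exponential map -/
  log : NilAlgebra c ω

namespace NilGroup

variable {c : CubicForm V} {ω : W [⋀^Fin 2]→ₗ[ℂ] ℂ} [Fact (Module.finrank ℂ W = 2)]

/-- The Campbell-Hausdorff product of a Lie algebra of nilpotency class at most three. -/
def campbellHausdorff (X Y : NilAlgebra c ω) : NilAlgebra c ω :=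
  X + Y + (1 / 2 : ℂ) • ⁅X, Y⁆ + (1 / 12 : ℂ) • ⁅X, ⁅X, Y⁆⁆ + (1 / 12 : ℂ) • ⁅Y, ⁅Y, X⁆⁆

/-- The group law of `N`, given by the Campbell-Hausdorff formula. -/
instance : Group (NilGroup c ω) where
  mul g h := exp (campbellHausdorff g.log h.log)
  one := exp 0
  inv g := exp (-g.log)
  mul_assoc := by
    rintro ⟨X⟩ ⟨Y⟩ ⟨Z⟩
    refine congrArg exp ?_
    change campbellHausdorff (campbellHausdorff X Y) Z = campbellHausdorff X (campbellHausdorff Y Z)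
    obtain ⟨x, φ, u⟩ := X
    obtain ⟨y, ψ, v⟩ := Y
    obtain ⟨z, χ, w⟩ := Z
    have h₁ := bracket₁₁_swap c ω y x
    have h₂ := bracket₁₁_swap c ω z x
    have h₃ := bracket₁₁_swap c ω z y
    have h : bracket₂₁ (bracket₁₁ c ω x z) y =
        bracket₂₁ (bracket₁₁ c ω x y) z + bracket₂₁ (bracket₁₁ c ω y z) x := by
      have h := bracket_cyclic c ω x y z
      rw [h₂, map_neg, LinearMap.neg_apply] at h
      linear_combination (norm := module) -h
    unfold campbellHausdorff
    ext1
    · simp only [NilAlgebra.add_p₁, NilAlgebra.smul_p₁, NilAlgebra.bracket_p₁]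
      module
    · simp only [NilAlgebra.add_p₁, NilAlgebra.smul_p₁, NilAlgebra.bracket_p₁, NilAlgebra.add_p₂,
        NilAlgebra.smul_p₂, NilAlgebra.bracket_p₂, map_add, map_smul, map_zero,
        LinearMap.add_apply, LinearMap.smul_apply, LinearMap.zero_apply]
      module
    · simp only [NilAlgebra.add_p₁, NilAlgebra.smul_p₁, NilAlgebra.bracket_p₁, NilAlgebra.add_p₂,
        NilAlgebra.smul_p₂, NilAlgebra.bracket_p₂, NilAlgebra.add_p₃, NilAlgebra.smul_p₃,
        NilAlgebra.bracket_p₃, map_add, map_smul, map_zero, map_neg,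
        LinearMap.add_apply, LinearMap.smul_apply, LinearMap.zero_apply, LinearMap.neg_apply,
        h₁, h₂, h₃, h]
      module
  one_mul := by
    rintro ⟨X⟩
    refine congrArg exp ?_
    change campbellHausdorff 0 X = X
    simp [campbellHausdorff]
  mul_one := by
    rintro ⟨X⟩
    refine congrArg exp ?_
    change campbellHausdorff X 0 = X
    simp [campbellHausdorff]
  inv_mul_cancel := by
    rintro ⟨X⟩
    refine congrArg exp ?_
    change campbellHausdorff (-X) X = 0
    simp [campbellHausdorff]

lemma mul_def (X Y : NilAlgebra c ω) :
    exp X * exp Y = exp (campbellHausdorff X Y) := rfl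

lemma one_def : (1 : NilGroup c ω) = exp 0 := rfl

lemma inv_def (X : NilAlgebra c ω) : (exp X)⁻¹ = exp (-X) := rfl

end NilGroup

/-- The linear subspace `V ⊗ ℓ` of `V ⊗ W`, for a line `ℓ` in `W`. -/
def tensorLine (V : Type u) [AddCommGroup V] [Module ℂ V] (ℓ : ℙ ℂ W) : Submodule ℂ (V ⊗[ℂ] W) :=
  LinearMap.range (LinearMap.lTensor V ℓ.submodule.subtype)

lemma bracket₁₁_tensorLine (c : CubicForm V) (ω : W [⋀^Fin 2]→ₗ[ℂ] ℂ) (ℓ : ℙ ℂ W)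
    {a a' : V ⊗[ℂ] W} (ha : a ∈ tensorLine V ℓ) (ha' : a' ∈ tensorLine V ℓ) :
    bracket₁₁ c ω a a' = 0 := by
  obtain ⟨a, rfl⟩ := ha
  obtain ⟨a', rfl⟩ := ha'
  induction a with
  | zero => simp
  | add x y hx hy => simp only [map_add, LinearMap.add_apply, hx, hy, add_zero]
  | tmul v w =>
    induction a' with
    | zero => simp
    | add x y hx hy => simp only [map_add, hx, hy, add_zero]
    | tmul v' w' =>
      obtain ⟨w, hw⟩ := w
      obtain ⟨w', hw'⟩ := w'
      rw [Projectivization.submodule_eq, Submodule.mem_span_singleton] at hw hw'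
      obtain ⟨r, rfl⟩ := hw
      obtain ⟨s, rfl⟩ := hw'
      have h : twoFormBilin ω (r • ℓ.rep) (s • ℓ.rep) = 0 := by simp [twoFormBilin_self]
      simp only [twoFormBilin_apply] at h
      simp only [LinearMap.lTensor_tmul, Submodule.subtype_apply, bracket₁₁_tmul, h, zero_smul]

section

variable [Fact (Module.finrank ℂ W = 2)] (c : CubicForm V) (ω : W [⋀^Fin 2]→ₗ[ℂ] ℂ)

/-- The abelian subgroup `A_ℓ = exp (V ⊗ ℓ)` of `N`. -/
def lineSubgroup (ℓ : ℙ ℂ W) : Subgroup (NilGroup c ω) where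
  carrier := {g | ∃ a ∈ tensorLine V ℓ, g = NilGroup.exp ⟨a, 0, 0⟩}
  mul_mem' := by
    rintro _ _ ⟨a, ha, rfl⟩ ⟨a', ha', rfl⟩
    refine ⟨a + a', add_mem ha ha', ?_⟩
    rw [NilGroup.mul_def]
    congr 1
    ext1 <;> simp [NilGroup.campbellHausdorff, bracket₁₁_tensorLine c ω ℓ ha ha',
      bracket₁₁_tensorLine c ω ℓ ha' ha]
  one_mem' := ⟨0, zero_mem _, rfl⟩
  inv_mem' := by
    rintro _ ⟨a, ha, rfl⟩
    refine ⟨-a, neg_mem ha, ?_⟩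
    rw [NilGroup.inv_def]
    congr 1
    ext1 <;> simp

/-- The group `N` as an algebraic variety: the exponential map is an isomorphism from the affine
space `𝔫` to `N`. -/
def nilGroupVariety : SpaceWithFunctions.{max u v} :=
  (SpaceWithFunctions.affineSpace (NilAlgebra c ω)).coinduced (NilGroup.exp (c := c) (ω := ω))

/-- The quotient map `ξ` from `N × ℙ W` to the family of the quotients `N ⧸ A_ℓ`, `ℓ ∈ ℙ W`. -/
def relativeQuotientMap :
    (nilGroupVariety c ω).prod (SpaceWithFunctions.projectiveSpace W) →
      Σ ℓ : ℙ ℂ W, NilGroup c ω ⧸ lineSubgroup c ω ℓ :=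
  fun z => ⟨z.2, QuotientGroup.mk (s := lineSubgroup c ω z.2) z.1⟩

/-- The variety `X_c`: the family of the quotients `N ⧸ A_ℓ`, `ℓ ∈ ℙ W`, with the structure of a
quotient of the product variety `N × ℙ W`. -/
def cubicVariety : SpaceWithFunctions.{max u v} :=
  ((nilGroupVariety c ω).prod (SpaceWithFunctions.projectiveSpace W)).coinduced
    (relativeQuotientMap c ω)

end

end

end

/-!
For a fixed element `n` of `N` the map `ℓ ↦ n A_ℓ` is a non-constant morphism from `ℙ W ≅ ℙ¹` to
`X_c`; let `C_n` be its image. If `a ∈ A_ℓ`, then `n A_ℓ = n a A_ℓ` is a common point of `C_n` and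
`C_{na}`. So all points of `C_n` are joined by chains to all points of `C_{ng}` for each `g` in the
subgroup generated by the `A_ℓ` (`chain_mul`). This subgroup is `N` (`iSup_lineSubgroup`), because
the Lie algebra `𝔫` is generated by `𝔫₁`: commutators of the `exp (v ⊗ w)` give all of `V*` modulo
`𝔫₃`, as `B` is surjective, and commutators of these with the `exp (v ⊗ w)` give all of `𝔫₃ = W`.

A regular function on `ℙ¹` is constant (`regular_projectiveLine_const`): it is an entire function in
each of the two standard affine coordinates `t` and `1 / t`, so it is bounded, and Liouville's
theorem applies. Hence a regular function on a rationally chain connected space is constant along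
each chain of rational curves (`RationallyChainConnected.quasiComplete`).
-/

open scoped TensorProduct Topology LinearAlgebra.Projectivization

universe u₁ u₂ u₃

/-! ### Morphisms of spaces with functions -/

namespace SpaceWithFunctions

lemma IsMorphism.comp {X : SpaceWithFunctions.{u₁}} {Y : SpaceWithFunctions.{u₂}}
    {Z : SpaceWithFunctions.{u₃}} {ψ : Y → Z} {φ : X → Y} (hψ : IsMorphism ψ)
    (hφ : IsMorphism φ) : IsMorphism (X := X) (Y := Z) (ψ ∘ φ) where
  continuous := hψ.continuous.comp hφ.continuous
  regularAt_comp f x hf := hφ.regularAt_comp (f ∘ ψ) x (hψ.regularAt_comp f (φ x) hf)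

lemma isMorphism_coinduced (X : SpaceWithFunctions.{u₁}) {Q : Type u₂} (q : X → Q) :
    IsMorphism (X := X) (Y := X.coinduced q) q where
  continuous := continuous_coinduced_rng
  regularAt_comp := by
    rintro f x ⟨U, -, hx, hf⟩
    exact hf x hx

lemma IsMorphism.of_comp_coinduced {X : SpaceWithFunctions.{u₁}} {Q : Type u₂} {q : X → Q}
    {Y : SpaceWithFunctions.{u₃}} {φ : Q → Y} (h : IsMorphism (X := X) (Y := Y) (φ ∘ q)) :
    IsMorphism (X := X.coinduced q) (Y := Y) φ where
  continuous := continuous_coinduced_dom.2 h.continuous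
  regularAt_comp f y hf := by
    obtain ⟨U, hU, hUo, hyU⟩ := eventually_nhds_iff.1 (Y.regularAt_eventually hf)
    refine ⟨φ ⁻¹' U, isOpen_coinduced.2 (hUo.preimage h.continuous), hyU, fun x hx => ?_⟩
    exact h.regularAt_comp f x (hU _ hx)

lemma IsMorphism.subspaceMap {X : SpaceWithFunctions.{u₁}} {Y : SpaceWithFunctions.{u₂}}
    {φ : X → Y} (h : IsMorphism φ) {S : Set X} {T : Set Y} (hST : Set.MapsTo φ S T) :
    IsMorphism (X := X.subspace S) (Y := Y.subspace T) (hST.restrict φ S T) where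
  continuous := h.continuous.restrict hST
  regularAt_comp := by
    rintro f x ⟨g, hg, hfg⟩
    refine ⟨g ∘ φ, h.regularAt_comp g x.1 hg, ?_⟩
    exact (h.continuous.restrict hST).continuousAt.eventually hfg

/-- A map that takes values in a subset `T` is a morphism to the subspace `T`. -/
lemma IsMorphism.codRestrict {X : SpaceWithFunctions.{u₁}} {Y : SpaceWithFunctions.{u₂}}
    {φ : X → Y} (h : IsMorphism φ) {T : Set Y} (hT : ∀ x, φ x ∈ T) :
    IsMorphism (X := X) (Y := Y.subspace T) (Set.codRestrict φ T hT) where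
  continuous := h.continuous.codRestrict hT
  regularAt_comp := by
    rintro f x ⟨g, hg, hfg⟩
    refine X.regularAt_congr ?_ (h.regularAt_comp g x hg)
    filter_upwards [(h.continuous.codRestrict hT).continuousAt.eventually hfg] with y hy
    exact hy.symm

/-- Morphisms to a space of local fractions may be tested on the charts: it suffices that the
domains have open preimages and that the functions in the given algebras pull back to regular
functions. -/
lemma isMorphism_localFractions {X : SpaceWithFunctions.{u₁}} {T : Type u₂} {ι : Type u₃}
    {dom : ι → Set T} {alg : ι → Subalgebra ℂ (T → ℂ)} {cover : ∀ z, ∃ i, z ∈ dom i}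
    {inter : ∀ i j, ∃ k, dom k = dom i ∩ dom j ∧ alg i ≤ alg k ∧ alg j ≤ alg k} {φ : X → T}
    (hdom : ∀ i, IsOpen (φ ⁻¹' dom i))
    (halg : ∀ i, ∀ p ∈ alg i, X.RegularOn (p ∘ φ) (φ ⁻¹' dom i)) :
    IsMorphism (X := X) (Y := localFractions dom alg cover inter) φ where
  continuous := by
    refine continuous_def.2 fun S hS => isOpen_iff_eventually.2 fun x hx => ?_
    obtain ⟨i, hi, q, hq, hqx, H⟩ := hS (φ x) hx
    filter_upwards [(hdom i).mem_nhds hi, X.eventually_ne_zero (halg i q hq x hi) hqx]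
      with y h1 h2 using H _ h1 h2
  regularAt_comp := by
    rintro f x ⟨i, hi, p, hp, q, hq, hqx, H⟩
    refine X.regularAt_congr ?_
      (X.regularAt_mul (halg i p hp x hi) (X.regularAt_inv (halg i q hq x hi) hqx))
    filter_upwards [(hdom i).mem_nhds hi, X.eventually_ne_zero (halg i q hq x hi) hqx]
      with y h1 h2
    exact (H (φ y) h1 h2).symm

/-- The inclusion of the slice `{x} × Y` into `X × Y` is a morphism. -/
lemma isMorphism_prodMk (X : SpaceWithFunctions.{u₁}) (Y : SpaceWithFunctions.{u₂}) (x : X) :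
    IsMorphism (X := Y) (Y := X.prod Y) (fun y => (x, y)) := by
  refine isMorphism_localFractions (fun i => ?_) (fun i p hp y hy => ?_)
  · by_cases hx : x ∈ i.1
    · convert i.2.isOpen using 1
      ext y
      simp [hx]
    · convert isOpen_empty using 1
      ext y
      simp [hx]
  · induction hp using Algebra.adjoin_induction with
    | mem p hp =>
      rcases hp with ⟨f, -, rfl⟩ | ⟨g, hg, rfl⟩
      · exact Y.regularAt_const (f x) y
      · exact hg y hy.2
    | algebraMap r => exact Y.regularAt_const r y
    | add p q _ _ hp hq => exact Y.regularAt_add hp hq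
    | mul p q _ _ hp hq => exact Y.regularAt_mul hp hq

/-! ### Affine and projective spaces -/

section Affine

variable {E : Type u₁} [AddCommGroup E] [Module ℂ E] {F : Type u₂} [AddCommGroup F] [Module ℂ F]

lemma regularAt_of_mem_polynomialFunctions {p : E → ℂ} (hp : p ∈ polynomialFunctions E) (x : E) :
    (affineSpace E).RegularAt p x :=
  ⟨(), trivial, p, hp, 1, one_mem _, by simp, by simp⟩

lemma comp_affineMap_mem_polynomialFunctions (L : E →ᵃ[ℂ] F) {p : F → ℂ}
    (hp : p ∈ polynomialFunctions F) : p ∘ L ∈ polynomialFunctions E := by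
  induction hp using Algebra.adjoin_induction with
  | mem p hp =>
    obtain ⟨φ, rfl⟩ := hp
    have h : (fun x : F => φ x) ∘ L =
        (fun x => (φ ∘ₗ L.linear) x) + algebraMap ℂ (E → ℂ) (φ (L 0)) := by
      funext x
      rw [AffineMap.decomp L]
      simp
    rw [h]
    exact add_mem (Algebra.subset_adjoin ⟨φ ∘ₗ L.linear, rfl⟩) (Subalgebra.algebraMap_mem _ _)
  | algebraMap r => exact Subalgebra.algebraMap_mem _ r
  | add p q _ _ hp hq => exact add_mem hp hq
  | mul p q _ _ hp hq => exact mul_mem hp hq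

lemma isMorphism_affineMap (L : E →ᵃ[ℂ] F) :
    IsMorphism (X := affineSpace E) (Y := affineSpace F) L :=
  isMorphism_localFractions (fun _ => isOpen_univ) fun _ _ hp x _ =>
    regularAt_of_mem_polynomialFunctions (comp_affineMap_mem_polynomialFunctions L hp) x

lemma isMorphism_projectivization_map (L : E →ₗ[ℂ] F) (hL : Function.Injective L) :
    IsMorphism (X := projectiveSpace E) (Y := projectiveSpace F) (Projectivization.map L hL) := by
  have hmaps : Set.MapsTo L {x : E | x ≠ 0} {x : F | x ≠ 0} := fun x hx =>
    (map_ne_zero_iff L hL).2 hx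
  exact IsMorphism.of_comp_coinduced
    ((isMorphism_coinduced _ (Projectivization.mk' (K := ℂ) (V := F))).comp
      ((isMorphism_affineMap L.toAffineMap).subspaceMap hmaps))

/-- An affine map to `F` that avoids the origin induces a morphism to the projective space. -/
lemma isMorphism_projectivization_mk (L : E →ᵃ[ℂ] F) (hL : ∀ x, L x ≠ 0) :
    IsMorphism (X := affineSpace E) (Y := projectiveSpace F)
      (fun x => Projectivization.mk ℂ (L x) (hL x)) :=
  (isMorphism_coinduced ((affineSpace F).subspace {x : F | x ≠ 0})
    (Projectivization.mk' (K := ℂ) (V := F))).comp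
      ((isMorphism_affineMap L).codRestrict (T := {x : F | x ≠ 0}) hL)

end Affine

lemma differentiable_of_mem_polynomialFunctions {p : ℂ → ℂ} (hp : p ∈ polynomialFunctions ℂ) :
    Differentiable ℂ p := by
  induction hp using Algebra.adjoin_induction with
  | mem p hp =>
    obtain ⟨φ, rfl⟩ := hp
    exact (LinearMap.toContinuousLinearMap φ).differentiable
  | algebraMap r => exact differentiable_const r
  | add p q _ _ hp hq => exact hp.add hq
  | mul p q _ _ hp hq => exact hp.mul hq

/-- Regular functions on the affine line are holomorphic. -/
lemma differentiableAt_of_regularAt {f : ℂ → ℂ} {z : ℂ} (hf : (affineSpace ℂ).RegularAt f z) :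
    DifferentiableAt ℂ f z := by
  obtain ⟨_, _, p, hp, q, hq, hqz, H⟩ := hf
  have hp' := differentiable_of_mem_polynomialFunctions hp
  have hq' := differentiable_of_mem_polynomialFunctions hq
  refine ((hp' z).div (hq' z) hqz).congr_of_eventuallyEq ?_
  filter_upwards [hq'.continuous.continuousAt.eventually_ne hqz] with w hw
  exact H w trivial hw

/-- Two entire functions `h`, `k` with `h t = k (1 / t)` for `t ≠ 0` are equal to one constant. -/
lemma eq_of_entire_of_inv {h k : ℂ → ℂ} (hh : Differentiable ℂ h) (hk : Differentiable ℂ k)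
    (hhk : ∀ t, t ≠ 0 → h t = k t⁻¹) (t : ℂ) : h t = h 0 := by
  refine hh.apply_eq_apply_of_bounded ?_ t 0
  obtain ⟨A, hA⟩ := (isCompact_closedBall (0 : ℂ) 1).exists_bound_of_continuousOn
    hh.continuous.continuousOn
  obtain ⟨B, hB⟩ := (isCompact_closedBall (0 : ℂ) 1).exists_bound_of_continuousOn
    hk.continuous.continuousOn
  refine isBounded_iff_forall_norm_le.2 ⟨max A B, ?_⟩
  rintro _ ⟨s, rfl⟩
  rcases le_total ‖s‖ 1 with hs | hs
  · exact (hA s (by simpa using hs)).trans (le_max_left _ _)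
  · have hs0 : s ≠ 0 := norm_pos_iff.1 (one_pos.trans_le hs)
    rw [hhk s hs0]
    refine (hB _ ?_).trans (le_max_right _ _)
    simpa using inv_le_one_of_one_le₀ hs

lemma regular_projectiveLine_const {f : ℙ ℂ (Fin 2 → ℂ) → ℂ}
    (hf : (projectiveSpace (Fin 2 → ℂ)).RegularOn f Set.univ) (x y : ℙ ℂ (Fin 2 → ℂ)) :
    f x = f y := by
  -- the two affine lines `t ↦ (1, t)` and `t ↦ (t, 1)`
  let L (a b : Fin 2 → ℂ) : ℂ →ᵃ[ℂ] (Fin 2 → ℂ) := AffineMap.lineMap a (a + b)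
  have hL (a b : Fin 2 → ℂ) (t : ℂ) : L a b t = a + t • b := by
    simp [L, AffineMap.lineMap_apply, add_comm]
  have h₀ (t : ℂ) : L ![1, 0] ![0, 1] t ≠ 0 := fun h => by
    simpa [hL] using congrFun h 0
  have h₁ (t : ℂ) : L ![0, 1] ![1, 0] t ≠ 0 := fun h => by
    simpa [hL] using congrFun h 1
  have hdiff {M : ℂ →ᵃ[ℂ] (Fin 2 → ℂ)} (hM : ∀ t, M t ≠ 0) :
      Differentiable ℂ fun t => f (Projectivization.mk ℂ (M t) (hM t)) := fun t =>
    differentiableAt_of_regularAt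
      ((isMorphism_projectivization_mk M hM).regularAt_comp f t (hf _ trivial))
  have hinv (t : ℂ) (ht : t ≠ 0) : Projectivization.mk ℂ _ (h₀ t) =
      Projectivization.mk ℂ _ (h₁ t⁻¹) := by
    refine (Projectivization.mk_eq_mk_iff' ℂ _ _ _ _).2 ⟨t, ?_⟩
    ext i
    fin_cases i <;> simp [hL, ht]
  have c₀ := eq_of_entire_of_inv (hdiff h₀) (hdiff h₁) fun t ht => by rw [hinv t ht]
  have c₁ := eq_of_entire_of_inv (hdiff h₁) (hdiff h₀) fun t ht => by
    rw [hinv t⁻¹ (inv_ne_zero ht)]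
    simp only [inv_inv]
  have key (z : ℙ ℂ (Fin 2 → ℂ)) : f z = f (Projectivization.mk ℂ _ (h₀ 0)) := by
    induction z using Projectivization.ind with
    | h v hv =>
      by_cases hv0 : v 0 = 0
      · have hv1 : v 1 ≠ 0 := fun hv1 => hv (by ext i; fin_cases i <;> simp [hv0, hv1])
        have e : Projectivization.mk ℂ v hv = Projectivization.mk ℂ _ (h₁ 0) := by
          refine (Projectivization.mk_eq_mk_iff' ℂ _ _ _ _).2 ⟨v 1, ?_⟩
          ext i
          fin_cases i <;> simp [hL, hv0]
        -- the constants on the two lines agree, as the lines meet over the point `(1 : 1)`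
        have e' := hinv 1 one_ne_zero
        simp only [inv_one] at e'
        rw [e, ← c₀ 1, ← c₁ 1, e']
      · have e : Projectivization.mk ℂ v hv = Projectivization.mk ℂ _ (h₀ (v 1 / v 0)) := by
          refine (Projectivization.mk_eq_mk_iff' ℂ _ _ _ _).2 ⟨v 0, ?_⟩
          ext i
          fin_cases i <;> simp [hL]
          field_simp
        rw [e, c₀]
  rw [key x, key y]

lemma RationallyChainConnected.quasiComplete {X : SpaceWithFunctions.{u₁}}
    (hX : X.RationallyChainConnected) : X.QuasiComplete := by
  intro f hf
  rcases isEmpty_or_nonempty X with hX' | ⟨⟨x₀⟩⟩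
  · exact ⟨0, fun x => hX'.elim x⟩
  refine ⟨f x₀, fun x => ?_⟩
  induction hX x₀ x with
  | refl => rfl
  | tail _ h ih =>
    obtain ⟨_, ⟨φ, hφ, -, rfl⟩, ⟨s, rfl⟩, ⟨t, rfl⟩⟩ := h
    rw [← ih]
    exact regular_projectiveLine_const (f := f ∘ φ)
      (fun s _ => hφ.regularAt_comp f s (hf _ trivial)) t s

end SpaceWithFunctions

/-! ### Generation of the group by the abelian subgroups -/

section Generation

variable {V : Type u₁} [AddCommGroup V] [Module ℂ V] {W : Type u₂} [AddCommGroup W] [Module ℂ W]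
  {c : CubicForm V} {ω : W [⋀^Fin 2]→ₗ[ℂ] ℂ}

lemma exists_twoForm_eq_one (hω : ω ≠ 0) : ∃ w₁ w₂ : W, ω ![w₁, w₂] = 1 := by
  obtain ⟨m, hm⟩ : ∃ m, ω m ≠ 0 := by
    by_contra! h
    exact hω (AlternatingMap.ext h)
  have e : m = ![m 0, m 1] := by
    ext i
    fin_cases i <;> rfl
  rw [e] at hm
  refine ⟨(ω ![m 0, m 1])⁻¹ • m 0, m 1, ?_⟩
  rw [← twoFormBilin_apply, map_smul, LinearMap.smul_apply, twoFormBilin_apply, smul_eq_mul,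
    inv_mul_cancel₀ hm]

namespace NilGroup

lemma exp_eta (g : NilGroup c ω) : g = exp ⟨g.log.p₁, g.log.p₂, g.log.p₃⟩ := rfl

variable [Fact (Module.finrank ℂ W = 2)]

lemma log_mul_p₁ (g h : NilGroup c ω) : (g * h).log.p₁ = g.log.p₁ + h.log.p₁ := by
  change (campbellHausdorff g.log h.log).p₁ = _
  simp [campbellHausdorff]

lemma log_mul_p₂ (g h : NilGroup c ω) : (g * h).log.p₂ =
    g.log.p₂ + h.log.p₂ + (1 / 2 : ℂ) • bracket₁₁ c ω g.log.p₁ h.log.p₁ := by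
  change (campbellHausdorff g.log h.log).p₂ = _
  simp [campbellHausdorff]

lemma log_inv (g : NilGroup c ω) : g⁻¹.log = -g.log := rfl

lemma log_one : (1 : NilGroup c ω).log = 0 := rfl

lemma commutator_p₁ (g h : NilGroup c ω) : (g * h * g⁻¹ * h⁻¹).log.p₁ = 0 := by
  simp only [log_mul_p₁, log_inv, NilAlgebra.neg_p₁]
  abel

lemma commutator_p₂ (g h : NilGroup c ω) :
    (g * h * g⁻¹ * h⁻¹).log.p₂ = bracket₁₁ c ω g.log.p₁ h.log.p₁ := by
  simp only [log_mul_p₂, log_mul_p₁, log_inv, NilAlgebra.neg_p₁, NilAlgebra.neg_p₂, map_add,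
    map_neg, LinearMap.add_apply, LinearMap.neg_apply, bracket₁₁_self,
    bracket₁₁_swap c ω h.log.p₁ g.log.p₁]
  module

lemma commutator_of_p₁_eq_zero (φ : Module.Dual ℂ V) (u : W) (x : V ⊗[ℂ] W) :
    exp (c := c) (ω := ω) ⟨0, φ, u⟩ * exp ⟨x, 0, 0⟩ * (exp ⟨0, φ, u⟩)⁻¹ * (exp ⟨x, 0, 0⟩)⁻¹ =
      exp ⟨0, 0, bracket₂₁ φ x⟩ := by
  have h : exp (c := c) (ω := ω) ⟨0, φ, u⟩ * exp ⟨x, 0, 0⟩ =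
      exp ⟨0, 0, bracket₂₁ φ x⟩ * (exp ⟨x, 0, 0⟩ * exp ⟨0, φ, u⟩) := by
    simp only [mul_def]
    congr 1
    ext1
    · simp [campbellHausdorff]
    · simp [campbellHausdorff]
    · simp [campbellHausdorff]
      module
  rw [h]
  group

lemma exp_mul_exp_of_p₁_eq_zero (φ ψ : Module.Dual ℂ V) (u v : W) :
    exp (c := c) (ω := ω) ⟨0, φ, u⟩ * exp ⟨0, ψ, v⟩ = exp ⟨0, φ + ψ, u + v⟩ := by
  rw [mul_def]
  congr 1
  ext1 <;> simp [campbellHausdorff]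

/-- A subgroup containing the elements `exp (v ⊗ w)` is everything: by commutators one obtains
first `V*` modulo the centre `W`, then the centre. -/
lemma eq_top_of_exp_tmul_mem [Nontrivial V] (hω : ω ≠ 0) (hc : Function.Surjective c.quadrics)
    (H : Subgroup (NilGroup c ω))
    (hH : ∀ (v : V) (w : W), exp ⟨v ⊗ₜ w, 0, 0⟩ ∈ H) : H = ⊤ := by
  have comm {g h : NilGroup c ω} (hg : g ∈ H) (hh : h ∈ H) : g * h * g⁻¹ * h⁻¹ ∈ H :=
    H.mul_mem (H.mul_mem (H.mul_mem hg hh) (H.inv_mem hg)) (H.inv_mem hh)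
  have h₁ (x : V ⊗[ℂ] W) : ∃ g ∈ H, g.log.p₁ = x := by
    induction x with
    | zero => exact ⟨1, H.one_mem, by simp [log_one]⟩
    | tmul v w => exact ⟨_, hH v w, rfl⟩
    | add x y hx hy =>
      obtain ⟨g, hg, rfl⟩ := hx
      obtain ⟨h, hh, rfl⟩ := hy
      exact ⟨g * h, H.mul_mem hg hh, log_mul_p₁ g h⟩
  have h₂ (φ : Module.Dual ℂ V) : ∃ u, exp ⟨0, φ, u⟩ ∈ H := by
    obtain ⟨s, rfl⟩ := hc φ
    induction s with
    | zero => exact ⟨0, by rw [map_zero]; exact H.one_mem⟩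
    | tmul v₁ v₂ =>
      obtain ⟨w₁, w₂, hw⟩ := exists_twoForm_eq_one hω
      have h := comm (hH v₁ w₁) (hH v₂ w₂)
      rw [exp_eta (_ * _), commutator_p₁, commutator_p₂, bracket₁₁_tmul, hw, one_smul] at h
      exact ⟨_, h⟩
    | add x y hx hy =>
      obtain ⟨u, hu⟩ := hx
      obtain ⟨v, hv⟩ := hy
      refine ⟨u + v, ?_⟩
      rw [map_add, ← exp_mul_exp_of_p₁_eq_zero]
      exact H.mul_mem hu hv
  have h₃ (w : W) : exp ⟨0, 0, w⟩ ∈ H := by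
    obtain ⟨v, hv⟩ := exists_ne (0 : V)
    obtain ⟨φ, hφ⟩ := Module.Projective.exists_dual_eq_one ℂ hv
    obtain ⟨u, hu⟩ := h₂ φ
    have h := comm hu (hH v w)
    rwa [commutator_of_p₁_eq_zero, bracket₂₁_tmul, hφ, one_smul] at h
  have h₂' (φ : Module.Dual ℂ V) (w : W) : exp ⟨0, φ, w⟩ ∈ H := by
    obtain ⟨u, hu⟩ := h₂ φ
    have h := H.mul_mem hu (h₃ (w - u))
    rwa [exp_mul_exp_of_p₁_eq_zero, add_zero, add_sub_cancel] at h
  refine (Subgroup.eq_top_iff' H).2 fun g => ?_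
  obtain ⟨h, hh, hgh⟩ := h₁ g.log.p₁
  -- `h⁻¹ * g` has no component in `𝔫₁`
  have e : (h⁻¹ * g).log.p₁ = 0 := by simp [log_mul_p₁, log_inv, hgh]
  have hm : h⁻¹ * g ∈ H := by
    rw [exp_eta (h⁻¹ * g), e]
    exact h₂' _ _
  simpa using H.mul_mem hh hm

end NilGroup

variable [Fact (Module.finrank ℂ W = 2)]

lemma iSup_lineSubgroup [Nontrivial V] (hω : ω ≠ 0) (hc : Function.Surjective c.quadrics) :
    ⨆ ℓ, lineSubgroup c ω ℓ = ⊤ := by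
  refine NilGroup.eq_top_of_exp_tmul_mem hω hc _ fun v w => ?_
  by_cases hw : w = 0
  · subst hw
    rw [TensorProduct.tmul_zero]
    exact one_mem _
  · refine Subgroup.mem_iSup_of_mem (Projectivization.mk ℂ w hw) ⟨v ⊗ₜ w, ?_, rfl⟩
    have hw' : w ∈ (Projectivization.mk ℂ w hw).submodule := by
      rw [Projectivization.submodule_mk]
      exact Submodule.mem_span_singleton_self w
    exact ⟨v ⊗ₜ ⟨w, hw'⟩, LinearMap.lTensor_tmul _ _ _ _⟩

/-! ### Chains of rational curves in the cubic variety -/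

open SpaceWithFunctions

/-- The image of `{n} × ℙ W` in `X_c` is a rational curve. -/
lemma isRationalCurve_range_relativeQuotientMap (n : NilGroup c ω) :
    (cubicVariety c ω).IsRationalCurve
      (Set.range fun ℓ : ℙ ℂ W => relativeQuotientMap c ω (n, ℓ)) := by
  have hfin : Module.finrank ℂ W = 2 := Fact.out
  have : FiniteDimensional ℂ W := Module.finite_of_finrank_pos (by omega)
  let e : (Fin 2 → ℂ) ≃ₗ[ℂ] W := LinearEquiv.ofFinrankEq _ _ (by simp [hfin])
  let P := Projectivization.map e.toLinearMap e.injective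
  have hPi : Function.Injective P := Projectivization.map_injective _ e.injective
  have hPs : Function.Surjective P := fun ℓ => by
    induction ℓ using Projectivization.ind with
    | h w hw =>
      refine ⟨Projectivization.mk ℂ (e.symm w) (by simpa using hw), ?_⟩
      simp [P, Projectivization.map_mk]
  have hP : IsMorphism (X := projectiveSpace (Fin 2 → ℂ)) (Y := projectiveSpace W) P :=
    isMorphism_projectivization_map e.toLinearMap e.injective
  refine ⟨fun s => relativeQuotientMap c ω (n, P s), ?_, ?_, ?_⟩
  · exact (isMorphism_coinduced _ (relativeQuotientMap c ω)).comp
      ((isMorphism_prodMk (nilGroupVariety c ω) (projectiveSpace W) n).comp hP)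
  · refine ⟨Projectivization.mk ℂ ![1, 0] (by simp), Projectivization.mk ℂ ![0, 1] (by simp),
      fun h => ?_⟩
    obtain ⟨a, ha⟩ := (Projectivization.mk_eq_mk_iff' ℂ _ _ _ _).1 (hPi (congrArg Sigma.fst h))
    simpa using congrFun ha 0
  · exact (hPs.range_comp fun ℓ : ℙ ℂ W => relativeQuotientMap c ω (n, ℓ)).symm

/-- Right multiplication by a product of elements of the subgroups `A_k` moves a point of `X_c` along a
chain of rational curves, each of the form `{n A_ℓ}` for a fixed `n`. -/
lemma chain_mul {g : NilGroup c ω} (hg : g ∈ ⨆ ℓ, lineSubgroup c ω ℓ) (n : NilGroup c ω)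
    (ℓ ℓ' : ℙ ℂ W) :
    Relation.ReflTransGen (fun a b => ∃ C, (cubicVariety c ω).IsRationalCurve C ∧ a ∈ C ∧ b ∈ C)
      (relativeQuotientMap c ω (n, ℓ)) (relativeQuotientMap c ω (n * g, ℓ')) := by
  have step (m : NilGroup c ω) (k k' : ℙ ℂ W) : ∃ C, (cubicVariety c ω).IsRationalCurve C ∧
      relativeQuotientMap c ω (m, k) ∈ C ∧ relativeQuotientMap c ω (m, k') ∈ C :=
    ⟨_, isRationalCurve_range_relativeQuotientMap m, ⟨k, rfl⟩, ⟨k', rfl⟩⟩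
  induction hg using Subgroup.iSup_induction' generalizing n ℓ ℓ' with
  | hp k a ha =>
    -- the curves of `n` and `n * a` meet in the coset `n A_k`
    have e : relativeQuotientMap c ω (n, k) = relativeQuotientMap c ω (n * a, k) :=
      congrArg (Sigma.mk k) (QuotientGroup.mk_mul_of_mem n ha).symm
    refine .tail (.single (step n ℓ k)) ?_
    rw [e]
    exact step (n * a) k ℓ'
  | h1 =>
    rw [mul_one]
    exact .single (step n ℓ ℓ')
  | hmul g h _ _ hg hh =>
    rw [← mul_assoc]
    exact (hg n ℓ ℓ).trans (hh (n * g) ℓ ℓ')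

end Generation

theorem proposition2 {V : Type*} [AddCommGroup V] [Module ℂ V] [FiniteDimensional ℂ V]
    [Nontrivial V] {W : Type*} [AddCommGroup W] [Module ℂ W] [Fact (Module.finrank ℂ W = 2)]
    (ω : W [⋀^Fin 2]→ₗ[ℂ] ℂ) (hω : ω ≠ 0)
    (c : CubicForm V) (hc : Function.Surjective c.quadrics) :
    (cubicVariety c ω).RationallyChainConnected ∧ (cubicVariety c ω).QuasiComplete := by
  suffices h : (cubicVariety c ω).RationallyChainConnected from ⟨h, h.quasiComplete⟩
  rintro ⟨ℓ, x⟩ ⟨ℓ', y⟩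
  induction x using QuotientGroup.induction_on with | _ n
  induction y using QuotientGroup.induction_on with | _ m
  have h := chain_mul (c := c) (ω := ω) (g := n⁻¹ * m)
    (by rw [iSup_lineSubgroup hω hc]; exact Subgroup.mem_top _) n ℓ ℓ'
  rwa [mul_inv_cancel_left] at h
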